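/- Let $p$ be a prime, $q=p^m$, and let $\omega,\beta\in\mathbb F_q$ with $\omega\neq 0,1$ and $\beta\neq 0$. Let $X=\mathbb F_q$ be the Alexander $f$-quandle with $x*y=\omega x+\beta y$ and $f(x)=x*x=(\omega+\beta)x$. For $n\ge 1$ let $C^n$ be the $\mathbb F_q$-vector space of all functions $X^n\to\mathbb F_q$, and let $\delta^n:C^n\to C^{n+1}$ be $$\delta^n\phi(x_1,\dots,x_{n+1})=(-1)^{n+1}\sum_{i=2}^{n+1}(-1)^i\Big(\phi(x_1,\dots,\widehat{x_i},\dots,x_{n+1})-\phi(x_1*x_i,\dots,x_{i-1}*x_i,f(x_{i+1}),\dots,f(x_{n+1}))\Big).$$ Let $Z_Q^2$ be the space of $\phi\in\ker\delta^2$ with $\phi(x,x)=0$ for all $x\in X$, and let $$H_Q^2((X,*,f);\mathbb F_q)=Z_Q^2/(Z_Q^2\cap\delta^1(C^1)).$$ Put $U_1=x_1-x_2$, $U_2=x_2$, and $$I=\{(v,u): 0\le v<u<m,\ \omega^{p^v+p^u}=1,\ (\omega+\beta)^{p^v+p^u}=1\}.$$ Then the monomials $U_1^{p^v}U_2^{p^u}$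 with $(v,u)\in I$ lie in $Z_Q^2$, and their classes, indexed by $I$, form a basis of $H_Q^2((X,*,f);\mathbb F_q)$ over $\mathbb F_q$. If the condition $\phi(x,x)=0$ is dropped, then the classes of these monomials together with the class of the constant function $1$ form a basis of $\ker\delta^2/\delta^1(C^1)$. -/

import Mathlib

/-- An `f`-quandle: a set with a binary operation `*` and a self-map `f` satisfying
`x * x = f x`, unique solvability of `z * y = f x`, and `(x * y) * f z = (x * z) * (y * z)`. -/
structure FQuandle (X : Type*) where
  op : X → X → X
  f : X → X
  op_self : ∀ x, op x x = f x
  existsUnique_op : ∀ x y, ∃! z, op z y = f x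
  op_op : ∀ x y z, op (op x y) (f z) = op (op x z) (op y z)

/-- The Alexander `f`-quandle on a field `F`: `x * y = ω x + β y`, `f x = x * x = (ω + β) x`. -/
def alexanderFQuandle {F : Type*} [Field F] (ω β : F) (hω : ω ≠ 0) : FQuandle F where
  op x y := ω * x + β * y
  f x := (ω + β) * x
  op_self x := by ring
  existsUnique_op x y := by
    refine ⟨ω⁻¹ * ((ω + β) * x - β * y), ?_, ?_⟩
    · show ω * (ω⁻¹ * ((ω + β) * x - β * y)) + β * y = (ω + β) * x
      rw [mul_inv_cancel_left₀ hω]; ring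
    · intro z hz
      have hz' : ω * z = (ω + β) * x - β * y := eq_sub_of_add_eq hz
      rw [← hz', inv_mul_cancel_left₀ hω]
  op_op x y z := by ring

namespace FQuandle

variable {X : Type*} (Q : FQuandle X) (F : Type*) [Field F]

/-- The tuple `(x₁ * xᵢ, …, xᵢ₋₁ * xᵢ, f xᵢ₊₁, …, f xₙ₊₁)`.
Here the position `i ≥ 2` is written as `i = k + 2` with `k : Fin n`, so that `xᵢ` is
`x k.succ`, counting from `0`. -/
def act {n : ℕ} (k : Fin n) (x : Fin (n + 1) → X) : Fin n → X := fun j =>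
  if j ≤ k then Q.op (x j.castSucc) (x k.succ) else Q.f (x j.succ)

/-- The coboundary operator `δⁿ : Cⁿ → Cⁿ⁺¹` on `F`-valued cochains, where `Cⁿ` is the space of
all functions `Xⁿ → F`:
`(δⁿφ)(x₁, …, xₙ₊₁) = (-1)ⁿ⁺¹ ∑_{i=2}^{n+1} (-1)ⁱ φ(x₁, …, x̂ᵢ, …, xₙ₊₁)`
`  - (-1)ⁿ⁺¹ ∑_{i=2}^{n+1} (-1)ⁱ φ(x₁ * xᵢ, …, xᵢ₋₁ * xᵢ, f xᵢ₊₁, …, f xₙ₊₁)`. -/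
def delta (n : ℕ) : ((Fin n → X) → F) →ₗ[F] ((Fin (n + 1) → X) → F) where
  toFun φ x :=
    (-1) ^ (n + 1) * ∑ k : Fin n, (-1) ^ ((k : ℕ) + 2) * φ (k.succ.removeNth x)
      - (-1) ^ (n + 1) * ∑ k : Fin n, (-1) ^ ((k : ℕ) + 2) * φ (Q.act k x)
  map_add' φ ψ := by
    funext x
    simp only [Pi.add_apply, mul_add, Finset.sum_add_distrib]
    ring
  map_smul' c φ := by
    funext x
    simp only [Pi.smul_apply, smul_eq_mul, RingHom.id_apply, mul_sub, Finset.mul_sum]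
    congr 1 <;> exact Finset.sum_congr rfl fun k _ => by ring

/-- The `n`-cochains that vanish on every tuple `(x₁, …, xₙ)` with `xᵢ = xᵢ₊₁` for some
`i ≥ s` (indices from `1`; the entry `xᵢ` is `x ⟨i - 1, _⟩`). For `s = 1` these are the cochains
of quandle cohomology, for `s = 2` those vanishing on the late degenerate tuples. -/
def normalizedCochains (X : Type*) (F : Type*) [Field F] (s n : ℕ) :
    Submodule F ((Fin n → X) → F) where
  carrier := {φ | ∀ x : Fin n → X, ∀ (j : ℕ) (hj : j + 1 < n), s ≤ j + 1 →
    x ⟨j, Nat.lt_of_succ_lt hj⟩ = x ⟨j + 1, hj⟩ → φ x = 0}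
  add_mem' := by
    intro φ ψ hφ hψ x j hj hs hx
    rw [Pi.add_apply, hφ x j hj hs hx, hψ x j hj hs hx, add_zero]
  zero_mem' := fun _ _ _ _ _ => rfl
  smul_mem' := by
    intro c φ hφ x j hj hs hx
    rw [Pi.smul_apply, hφ x j hj hs hx, smul_zero]

/-- Normalized `n`-cocycles. -/
def cocycles (s n : ℕ) : Submodule F ((Fin n → X) → F) :=
  LinearMap.ker (Q.delta F n) ⊓ normalizedCochains X F s n

/-- Coboundaries of normalized cochains (zero in degree `0`). -/
def coboundaries (s : ℕ) : (n : ℕ) → Submodule F ((Fin n → X) → F)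
  | 0 => ⊥
  | n + 1 => (normalizedCochains X F s n).map (Q.delta F n)

/-- The cohomology `Hⁿ`: normalized cocycles modulo those normalized cocycles that are
coboundaries. -/
abbrev Cohomology (s n : ℕ) : Type _ :=
  Q.cocycles F s n ⧸ (Q.coboundaries F s n).comap (Q.cocycles F s n).subtype

/-- The cohomology class of a cocycle. -/
abbrev cohomologyClass (s n : ℕ) (z : Q.cocycles F s n) : Q.Cohomology F s n :=
  Submodule.Quotient.mk z

/-- The quandle cohomology `H_Qⁿ`: cochains vanish as soon as two adjacent entries agree. -/
abbrev HQ (n : ℕ) : Type _ := Q.Cohomology F 1 n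

/-- The cohomology obtained when only the late degenerate tuples (`xᵢ = xᵢ₊₁` for some `i ≥ 2`)
are divided out. For `n ≤ 2` it is the cohomology of the complex of all cochains. -/
abbrev HLate (n : ℕ) : Type _ := Q.Cohomology F 2 n

end FQuandle

/-- The `2`-cochain `U₁ᵃ U₂ᵇ`, where `U₁ = x₁ - x₂` and `U₂ = x₂`. -/
def monomialCochain {F : Type*} [Field F] (a b : ℕ) : (Fin 2 → F) → F :=
  fun x => (x 0 - x 1) ^ a * x 1 ^ b

/-- The pairs `(v, u)` with `0 ≤ v < u < m`, `ω ^ (p ^ v + p ^ u) = 1` and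
`(ω + β) ^ (p ^ v + p ^ u) = 1`. -/
def exponentPairs {F : Type*} [Field F] (p m : ℕ) (ω β : F) : Set (ℕ × ℕ) :=
  {e | e.1 < e.2 ∧ e.2 < m ∧ ω ^ (p ^ e.1 + p ^ e.2) = 1 ∧ (ω + β) ^ (p ^ e.1 + p ^ e.2) = 1}

/-!
Write `s = ω + β` and `q = p ^ m`. A `2`-cochain is uniquely a polynomial `∑ c a b U₁ᵃ U₂ᵇ` of
degree less than `q` in each variable. After substituting `x₁ = A + B + C`, `x₂ = B + C`, `x₃ = C`
the coboundary is again of degree less than `q` in each of `A, B, C`, and comparing coefficients of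
`Aⁱ Bʲ Cᵏ` turns the cocycle condition into
`c (i+j) k * (i+j choose i) * (1 - ωⁱ s^(j+k)) = c i (j+k) * (j+k choose j) * (1 - ω^(i+j) sᵏ)`
(`IsCocycleCoeffs`). This is homogeneous, so each total degree `d` can be treated separately.
The coboundary of `xᵈ` has coefficients `(d choose a) * (1 - ωᵃ s^(d-a))`.

If `s ^ d ≠ 1` or `ω ^ d ≠ 1`, the equations with `i = 0`, respectively `k = 0`, exhibit the degree
`d` part as a multiple of that coboundary. Otherwise only `τ = ω / s` matters
(`IsCocycleSlice`), and `slice_classification` shows that the degree `d` part is a multiple of the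
coboundary, up to one further coefficient when `d = p ^ v + p ^ u` with `v < u`. If `p ∣ d`, all
coefficients at indices prime to `p` vanish and Lucas' congruence allows one to divide everything
by `p`. If `p ∤ d`, the equations with `i = 1` determine the coefficients at indices `a` prime to
`p` from one scalar, those with `k = 1` determine the coefficients with `d - a` prime to `p` from
another one, and the two scalars agree unless `d = 1 + p ^ u`. In degrees `d ≥ q`, where `xᵈ` is not
available as a reduced polynomial, the coefficient at `a = q` forces everything to vanish
(`IsCocycleCoeffs.degree_classification`).

Hence every cocycle is a constant plus a combination of the monomials indexed by
`exponentPairs` plus a coboundary. For independence, a coboundary whose coefficient at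
`(p ^ u, p ^ v)` vanishes also has vanishing coefficient at `(p ^ v, p ^ u)`. The constant is
detected by the value at `(0, 0)`, where coboundaries and the monomials vanish; this also removes
it from the cocycles that vanish on the diagonal.
-/

/-! ### Binomial coefficients modulo a prime -/

section Binomial

variable {F : Type*} [Field F] {p : ℕ} [CharP F p]

theorem cast_choose_mul_mul (hp : p.Prime) (n k : ℕ) :
    (((p * n).choose (p * k) : ℕ) : F) = (n.choose k : ℕ) := by
  have := Fact.mk hp
  exact (CharP.natCast_eq_natCast F p).2 Choose.choose_mul_mul_modEq_choose_nat

theorem cast_choose_mul_of_not_dvd (hp : p.Prime) (n : ℕ) {k : ℕ} (hk : ¬ p ∣ k) :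
    (((p * n).choose k : ℕ) : F) = 0 := by
  have := Fact.mk hp
  have h := (CharP.natCast_eq_natCast F p).2
    (Choose.choose_modEq_choose_mod_mul_choose_div_nat (n := p * n) (k := k) (p := p))
  rw [h, Nat.mul_mod_right, Nat.choose_eq_zero_of_lt
    (Nat.pos_of_ne_zero fun h0 => hk (Nat.dvd_of_mod_eq_zero h0))]
  simp

theorem cast_choose_add_mul (hp : p.Prime) {r l : ℕ} (hr : r < p) (hl : l < p) (n k : ℕ) :
    (((r + p * n).choose (l + p * k) : ℕ) : F) = (r.choose l : ℕ) * (n.choose k : ℕ) := by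
  have := Fact.mk hp
  have h := (CharP.natCast_eq_natCast F p).2
    (Choose.choose_modEq_choose_mod_mul_choose_div_nat (n := r + p * n) (k := l + p * k) (p := p))
  rw [h, Nat.add_mul_mod_self_left, Nat.add_mul_mod_self_left, Nat.mod_eq_of_lt hr,
    Nat.mod_eq_of_lt hl, Nat.add_mul_div_left _ _ hp.pos, Nat.add_mul_div_left _ _ hp.pos,
    Nat.div_eq_of_lt hr, Nat.div_eq_of_lt hl]
  simp

theorem cast_choose_pow_mul_self (hp : p.Prime) (r n : ℕ) :
    (((p ^ r * n).choose (p ^ r) : ℕ) : F) = n := by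
  have := Fact.mk hp
  have h := (CharP.natCast_eq_natCast F p).2
    (Choose.choose_pow_mul_pow_mul_modEq_choose_nat (k := r) (a := n) (b := 1) (p := p))
  rwa [mul_one, Nat.choose_one_right] at h

theorem one_sub_pow_prime_pow_ne_zero (hp : p.Prime) {t : F} (ht : t ≠ 1) (r : ℕ) :
    1 - t ^ p ^ r ≠ 0 := by
  have := Fact.mk hp
  have : 1 - t ^ p ^ r = (1 - t) ^ p ^ r := by rw [sub_pow_char_pow, one_pow]
  rw [this]
  exact pow_ne_zero _ (sub_ne_zero.2 ht.symm)

end Binomial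

/-! ### Homogeneous cocycles -/

/-- The cocycle condition on the coefficients `c a` of a homogeneous cochain
`∑ c a • U₁ ^ a * U₂ ^ (d - a)`, in the case where the `d`-th powers of `ω` and `ω + β` are `1`;
then only the ratio `τ = ω / (ω + β)` enters. Only the values `c a` with `a ≤ d` matter. -/
def IsCocycleSlice {F : Type*} [Field F] (τ : F) (d : ℕ) (c : ℕ → F) : Prop :=
  ∀ i j k, i + j + k = d → c (i + j) * ((i + j).choose i : ℕ) * (1 - τ ^ i) =
    c i * ((j + k).choose j : ℕ) * (1 - τ ^ (i + j))

section Slice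

variable {F : Type*} [Field F] {p : ℕ} [CharP F p] {τ : F} {c : ℕ → F} {d : ℕ}

/-- For `p ∤ d` the relations with `i = 1` determine `c a` from `c 1` at all indices `a` prime
to `p`. -/
theorem slice_of_not_dvd_index (hτ : τ ≠ 1) (hd : ¬ p ∣ d)
    (hE : IsCocycleSlice τ d c)
    {a : ℕ} (had : a ≤ d) (ha : ¬ p ∣ a) :
    c a = c 1 / (d * (1 - τ)) * ((d.choose a : ℕ) * (1 - τ ^ a)) := by
  have hdF : (d : F) ≠ 0 := fun h => hd ((CharP.cast_eq_zero_iff F p d).1 h)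
  have haF : (a : F) ≠ 0 := fun h => ha ((CharP.cast_eq_zero_iff F p a).1 h)
  have hτ' : 1 - τ ≠ 0 := sub_ne_zero.2 hτ.symm
  obtain ⟨a, rfl⟩ : ∃ b, a = b + 1 :=
    Nat.exists_eq_succ_of_ne_zero (by rintro rfl; exact ha (dvd_zero p))
  obtain ⟨k, rfl⟩ := Nat.exists_eq_add_of_le had
  have h := hE 1 a k (by ring)
  rw [add_comm 1 a, Nat.choose_one_right, pow_one] at h
  have h2 : ((a + k + 1 : ℕ) : F) * ((a + k).choose a : ℕ) =
      ((a + 1 + k).choose (a + 1) : ℕ) * (a + 1 : ℕ) := by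
    rw [show a + 1 + k = a + k + 1 by ring]
    simpa only [Nat.cast_mul] using
      congrArg (Nat.cast (R := F)) (Nat.add_one_mul_choose_eq (a + k) a)
  rw [show a + k + 1 = a + 1 + k by ring] at h2
  field_simp
  apply mul_right_cancel₀ haF
  linear_combination ((a + 1 + k : ℕ) : F) * h + c 1 * (1 - τ ^ (a + 1)) * h2

/-- For `p ∤ d` the relations with `k = 1` determine `c a` from `c (d - 1)` at all indices `a`
with `d - a` prime to `p`. -/
theorem slice_of_not_dvd_coindex (hτ : τ ≠ 1) (hτd : τ ^ d = 1) (hd : ¬ p ∣ d)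
    (hE : IsCocycleSlice τ d c)
    {a b : ℕ} (had : a + b = d) (hb : ¬ p ∣ b) :
    c a = c (d - 1) / (d * (1 - τ ^ (d - 1))) * ((d.choose a : ℕ) * (1 - τ ^ a)) := by
  have hdF : (d : F) ≠ 0 := fun h => hd ((CharP.cast_eq_zero_iff F p d).1 h)
  have hbF : (b : F) ≠ 0 := fun h => hb ((CharP.cast_eq_zero_iff F p b).1 h)
  obtain ⟨b, rfl⟩ : ∃ b', b = b' + 1 :=
    Nat.exists_eq_succ_of_ne_zero (by rintro rfl; exact hb (dvd_zero p))
  subst had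
  rw [show a + (b + 1) - 1 = a + b by omega]
  have hτ' : 1 - τ ^ (a + b) ≠ 0 := by
    intro h
    rw [sub_eq_zero] at h
    rw [← add_assoc, pow_succ, ← h, one_mul] at hτd
    exact hτ hτd
  have h := hE a b 1 (by ring)
  rw [Nat.choose_succ_self_right] at h
  have h2 : ((a + b).choose a : F) * (a + (b + 1) : ℕ) =
      ((a + (b + 1)).choose a : ℕ) * (b + 1 : ℕ) := by
    have := Nat.choose_mul_succ_eq (a + b) a
    rw [show a + b + 1 - a = b + 1 by omega] at this
    simpa only [Nat.cast_mul, add_assoc] using congrArg (Nat.cast (R := F)) this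
  field_simp
  apply mul_right_cancel₀ hbF
  linear_combination -((a + (b + 1) : ℕ) : F) * h + c (a + b) * (1 - τ ^ a) * h2

/-- The case `p ∤ d`: the indices prime to `p` and those with complement prime to `p` cover
everything, and on each of the two families the slice is a multiple of the coboundary slice. -/
theorem slice_of_not_dvd (hp : p.Prime) (hτ : τ ≠ 1) (hτd : τ ^ d = 1) (hd : ¬ p ∣ d)
    (hE : IsCocycleSlice τ d c) :
    ∃ l : F, ∀ a ≤ d, c a = l * ((d.choose a : ℕ) * (1 - τ ^ a)) ∨
      ∃ v u, v < u ∧ a = p ^ v ∧ d = p ^ v + p ^ u := by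
  have h1 := fun a => slice_of_not_dvd_index (a := a) hτ hd hE
  have h2 := fun a b => slice_of_not_dvd_coindex (a := a) (b := b) hτ hτd hd hE
  set l₁ := c 1 / (d * (1 - τ))
  set l₂ := c (d - 1) / (d * (1 - τ ^ (d - 1)))
  have hdF : (d : F) ≠ 0 := fun h => hd ((CharP.cast_eq_zero_iff F p d).1 h)
  have hτ' : 1 - τ ≠ 0 := sub_ne_zero.2 hτ.symm
  have hp1 : ¬ p ∣ 1 := hp.one_lt.ne' ∘ Nat.dvd_one.1
  have hd0 : d ≠ 0 := by rintro rfl; exact hd (dvd_zero p)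
  have cover : ∀ a ≤ d, ¬ p ∣ a ∨ ¬ p ∣ d - a := fun a ha => by
    by_contra! h
    exact hd (by simpa [Nat.add_sub_cancel' ha] using dvd_add h.1 h.2)
  -- once the two multiples agree, the slice is a coboundary
  have done : l₁ = l₂ → ∀ a ≤ d, c a = l₂ * ((d.choose a : ℕ) * (1 - τ ^ a)) := by
    intro h a ha
    rcases cover a ha with h' | h'
    · rw [h1 a ha h', h]
    · exact h2 a _ (Nat.add_sub_cancel' ha) h'
  -- in the exceptional degrees `1 + p ^ u`, `l₂` is the scalar seen at the index `p ^ u`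
  refine ⟨l₂, ?_⟩
  by_cases hd1 : p ∣ d - 1
  swap
  · have e1 := h1 1 (by omega) hp1
    have e2 := h2 1 (d - 1) (by omega) hd1
    rw [e1, Nat.choose_one_right, pow_one] at e2
    exact fun a ha => Or.inl (done (mul_right_cancel₀ (mul_ne_zero hdF hτ') e2) a ha)
  have hd1' : d - 1 ≠ 0 := fun h => hτ (by simpa [show d = 1 by omega] using hτd)
  obtain ⟨u, w, hw, hdw⟩ := Nat.exists_eq_pow_mul_and_not_dvd hd1' p hp.ne_one
  obtain ⟨u, rfl⟩ : ∃ u', u = u' + 1 := Nat.exists_eq_succ_of_ne_zero (by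
    rintro rfl
    rw [pow_zero, one_mul] at hdw
    exact hw (hdw ▸ hd1))
  obtain rfl : d = 1 + p ^ (u + 1) * w := by omega
  by_cases hw1 : w = 1
  · subst hw1
    rw [mul_one] at *
    intro a ha
    by_cases ha1 : a = 1
    · exact Or.inr ⟨0, u + 1, by omega, by simpa using ha1, by simp⟩
    left
    by_cases hpa : p ∣ a
    · rcases cover a ha with h' | h'
      · exact absurd hpa h'
      · exact h2 a _ (Nat.add_sub_cancel' ha) h'
    rw [h1 a ha hpa]
    -- the only binomial coefficients prime to `p` are those at `0`, `1`, `p ^ (u + 1)`, `d`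
    have hx : ((1 + p ^ (u + 1)).choose a : F) * (1 - τ ^ a) = 0 := by
      rcases ha.eq_or_lt with rfl | hlt
      · rw [hτd, sub_self, mul_zero]
      obtain ⟨b, rfl⟩ : ∃ b, a = b + 1 :=
        Nat.exists_eq_succ_of_ne_zero (by rintro rfl; exact hpa (dvd_zero p))
      have hb1 : p ∣ (p ^ (u + 1)).choose (b + 1) := hp.dvd_choose_pow (by omega)
        (by rintro h; exact hpa (h ▸ dvd_pow_self p (by omega)))
      have hb2 : p ∣ (p ^ (u + 1)).choose b := hp.dvd_choose_pow (by omega) (by omega)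
      rw [add_comm 1, Nat.choose_succ_succ,
        (CharP.cast_eq_zero_iff F p _).2 (dvd_add hb2 hb1), zero_mul]
    rw [hx, mul_zero, mul_zero]
  · -- compare the two families across a step from `U = p ^ (u + 1)` to `U + j`
    suffices h : ∃ j k, 1 + p ^ (u + 1) * w = p ^ (u + 1) + j + k ∧ ¬ p ∣ p ^ (u + 1) + j ∧
        ((j + k).choose j : F) ≠ 0 ∧ 1 - τ ^ (p ^ (u + 1) + j) ≠ 0 by
      obtain ⟨j, k, hjk, hj, hC, hτj⟩ := h
      refine fun a ha => Or.inl (done ?_ a ha)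
      have e := hE (p ^ (u + 1)) j k hjk.symm
      have e1 := h1 (p ^ (u + 1) + j) (by omega) hj
      have hpj : ¬ p ∣ j + k := by
        intro h
        refine hd ?_
        rw [hjk, add_assoc]
        exact dvd_add (dvd_pow_self p (by omega)) h
      have e2 := h2 (p ^ (u + 1)) (j + k) (by omega) hpj
      have hU : ((1 + p ^ (u + 1) * w).choose (p ^ (u + 1)) : F) ≠ 0 := by
        have h := cast_choose_add_mul (F := F) hp hp.one_lt hp.pos (p ^ u * w) (p ^ u)
        rw [cast_choose_pow_mul_self hp, ← mul_assoc, ← pow_succ', zero_add] at h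
        rw [h]
        simpa using fun h => hw ((CharP.cast_eq_zero_iff F p _).1 h)
      have hm : ((1 + p ^ (u + 1) * w).choose (p ^ (u + 1) + j) : F) *
          ((p ^ (u + 1) + j).choose (p ^ (u + 1)) : ℕ) =
          ((1 + p ^ (u + 1) * w).choose (p ^ (u + 1)) : ℕ) * ((j + k).choose j : ℕ) := by
        have := Nat.choose_mul (n := 1 + p ^ (u + 1) * w) (k := p ^ (u + 1) + j)
          (s := p ^ (u + 1)) (by omega)
        rw [Nat.add_sub_cancel_left,
          show 1 + p ^ (u + 1) * w - p ^ (u + 1) = j + k by omega] at this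
        simpa only [Nat.cast_mul] using congrArg (Nat.cast (R := F)) this
      rw [e1, e2] at e
      refine mul_right_cancel₀ (mul_ne_zero (mul_ne_zero hU hC) (mul_ne_zero hτj
        (one_sub_pow_prime_pow_ne_zero hp hτ (u + 1)))) ?_
      linear_combination e - l₁ * (1 - τ ^ (p ^ (u + 1) + j)) * (1 - τ ^ p ^ (u + 1)) * hm
    obtain ⟨w, rfl⟩ : ∃ w', w = w' + 1 :=
      Nat.exists_eq_succ_of_ne_zero (by rintro rfl; exact hw (dvd_zero p))
    have hw0 : w ≠ 0 := by omega
    have hpU : p ∣ p ^ (u + 1) := dvd_pow_self p (by omega)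
    -- `j = 1` works unless `τ ^ (U + 1) = 1`; then `j = 1 + U * p ^ r` does, with `p ^ r` the
    -- exact power of `p` in the cofactor `w`
    by_cases hτU : τ ^ (p ^ (u + 1) + 1) = 1
    · obtain ⟨r, z, hz, rfl⟩ := Nat.exists_eq_pow_mul_and_not_dvd hw0 p hp.ne_one
      have hz0 : 0 < z := Nat.pos_of_ne_zero (by rintro rfl; exact hz (dvd_zero p))
      obtain ⟨k, hk⟩ : ∃ k, p ^ (u + 1) * (p ^ r * z) = p ^ (u + 1 + r) + k := by
        refine Nat.exists_eq_add_of_le ?_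
        rw [← mul_assoc, ← pow_add]
        exact Nat.le_mul_of_pos_right _ hz0
      refine ⟨1 + p ^ (u + 1 + r), k, by rw [mul_add, hk]; ring, ?_, ?_, ?_⟩
      · rw [← add_assoc, add_right_comm, Nat.dvd_add_right
          (dvd_add hpU (dvd_pow_self p (by omega)))]
        exact hp1
      · have h := cast_choose_add_mul (F := F) hp hp.one_lt hp.one_lt (p ^ (u + r) * z)
          (p ^ (u + r))
        rw [cast_choose_pow_mul_self hp, ← mul_assoc, ← pow_succ', Nat.choose_self] at h
        rw [add_assoc, ← hk, show p ^ (u + 1) * (p ^ r * z) = p ^ (u + r + 1) * z by ring,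
          show u + 1 + r = u + r + 1 by ring, h]
        simpa using fun h => hz ((CharP.cast_eq_zero_iff F p _).1 h)
      · rw [← add_assoc, pow_add, hτU, one_mul]
        exact one_sub_pow_prime_pow_ne_zero hp hτ _
    · refine ⟨1, p ^ (u + 1) * w, by ring, ?_, ?_, sub_ne_zero.2 (Ne.symm hτU)⟩
      · rwa [Nat.dvd_add_right hpU]
      · rw [Nat.choose_one_right, pow_succ', mul_assoc]
        simp

/-- If the degree is divisible by `p`, the coefficients at indices prime to `p` vanish. They are
multiples of `c 1`, and `c 1 = 0` by the relation `(i, j) = (1, p - 1)`, where the binomial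
coefficient `(p choose 1)` is zero. -/
theorem slice_eq_zero_of_not_dvd_index (hp : p.Prime) (hτ : τ ≠ 1) (hd0 : d ≠ 0)
    (hE : IsCocycleSlice τ (p * d) c)
    {a : ℕ} (had : a ≤ p * d) (ha : ¬ p ∣ a) : c a = 0 := by
  obtain ⟨d, rfl⟩ := Nat.exists_eq_succ_of_ne_zero hd0
  have hp1 := hp.one_lt
  have hc1 : c 1 = 0 := by
    have h := hE 1 (p - 1) (p * d) (by rw [Nat.mul_succ]; omega)
    have hC := cast_choose_add_mul (F := F) hp (Nat.sub_lt hp.pos one_pos)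
      (Nat.sub_lt hp.pos one_pos) d 0
    rw [mul_zero, add_zero, Nat.choose_self, Nat.choose_zero_right] at hC
    rw [hC, Nat.add_sub_cancel' hp.pos, Nat.choose_one_right, CharP.cast_eq_zero] at h
    have := one_sub_pow_prime_pow_ne_zero hp hτ 1
    rw [pow_one] at this
    simpa [this] using h.symm
  obtain ⟨a, rfl⟩ : ∃ b, a = b + 1 :=
    Nat.exists_eq_succ_of_ne_zero (by rintro rfl; exact ha (dvd_zero p))
  obtain ⟨k, hk⟩ := Nat.exists_eq_add_of_le had
  have h := hE 1 a k (by rw [hk]; ring)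
  have haF : ((a + 1 : ℕ) : F) ≠ 0 := fun h => ha ((CharP.cast_eq_zero_iff F p _).1 h)
  rw [hc1, add_comm 1 a, Nat.choose_one_right, pow_one] at h
  simpa [sub_ne_zero.2 hτ.symm, haF, -Nat.cast_add] using h

/-- A slice of positive degree is a multiple of the coboundary slice
`(d choose a) * (1 - τ ^ a)`, except that for `d = p ^ v + p ^ u` with `v < u` the coefficient at
`p ^ v` is unconstrained. -/
theorem slice_classification (hp : p.Prime) (hd0 : d ≠ 0) (hτ : τ ≠ 1) (hτd : τ ^ d = 1)
    (hE : IsCocycleSlice τ d c) :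
    ∃ l : F, ∀ a ≤ d, c a = l * ((d.choose a : ℕ) * (1 - τ ^ a)) ∨
      ∃ v u, v < u ∧ a = p ^ v ∧ d = p ^ v + p ^ u := by
  induction d using Nat.strong_induction_on generalizing c τ with
  | _ d ih =>
  by_cases hd : p ∣ d
  swap
  · exact slice_of_not_dvd hp hτ hτd hd hE
  obtain ⟨d, rfl⟩ := hd
  have hd0' : d ≠ 0 := by rintro rfl; exact hd0 (mul_zero p)
  have hτp : τ ^ p ≠ 1 := by
    have := one_sub_pow_prime_pow_ne_zero hp hτ 1
    rw [pow_one] at this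
    exact fun h => this (by rw [h, sub_self])
  obtain ⟨l, hl⟩ := ih d (lt_mul_of_one_lt_left (Nat.pos_of_ne_zero hd0') hp.one_lt)
    (τ := τ ^ p) (c := fun a => c (p * a)) hd0' hτp (by rwa [← pow_mul]) (by
      intro i j k hijk
      have h := hE (p * i) (p * j) (p * k) (by rw [← hijk]; ring)
      rw [← mul_add, ← mul_add, cast_choose_mul_mul hp, cast_choose_mul_mul hp] at h
      simpa only [← pow_mul] using h)
  refine ⟨l, fun a ha => ?_⟩
  by_cases hpa : p ∣ a
  · obtain ⟨a, rfl⟩ := hpa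
    rcases hl a (Nat.le_of_mul_le_mul_left ha hp.pos) with h | ⟨v, u, hvu, rfl, rfl⟩
    · left
      rw [cast_choose_mul_mul hp, pow_mul]
      exact h
    · exact Or.inr ⟨v + 1, u + 1, by omega, by ring, by ring⟩
  · left
    rw [slice_eq_zero_of_not_dvd_index hp hτ hd0' hE ha hpa, cast_choose_mul_of_not_dvd hp d hpa]
    ring

end Slice

/-! ### Polynomial functions on a finite field -/

section PolynomialFunctions

variable {F : Type*} [Field F]

theorem natDegree_lt_of_degree_lt_natCast {P : Polynomial F} {n : ℕ} (hn : 0 < n)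
    (h : P.degree < n) : P.natDegree < n := by
  rcases eq_or_ne P 0 with rfl | hP
  · rwa [Polynomial.natDegree_zero]
  · exact (Polynomial.natDegree_lt_iff_degree_lt hP).2 h

open Finset Polynomial in
theorem eq_zero_of_sum_mul_pow_eq_zero [Finite F] {c : ℕ → F}
    (h : ∀ x : F, ∑ i ∈ range (Nat.card F), c i * x ^ i = 0) : ∀ i < Nat.card F, c i = 0 := by
  have := Fintype.ofFinite F
  rw [Nat.card_eq_fintype_card] at *
  set P : F[X] := ∑ i ∈ range (Fintype.card F), C (c i) * X ^ i
  have hdeg : P.degree < (Fintype.card F : ℕ) := by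
    refine (degree_sum_le _ _).trans_lt ((Finset.sup_lt_iff (WithBot.bot_lt_coe _)).2 ?_)
    intro i hi
    exact (degree_C_mul_X_pow_le i _).trans_lt (Nat.cast_lt.2 (mem_range.1 hi))
  have hP : P = 0 := by
    refine eq_zero_of_natDegree_lt_card_of_eval_eq_zero P Function.injective_id
      (fun x => ?_) (natDegree_lt_of_degree_lt_natCast Fintype.card_pos hdeg)
    simpa [P, eval_finsetSum] using h x
  intro i hi
  have := congrArg (fun Q : F[X] => Q.coeff i) hP
  simpa [P, finsetSum_coeff, coeff_C_mul, coeff_X_pow, hi] using this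

open Finset Polynomial in
theorem exists_eq_sum_mul_pow [Finite F] (f : F → F) :
    ∃ c : ℕ → F, (∀ a, Nat.card F ≤ a → c a = 0) ∧
      ∀ x, f x = ∑ i ∈ range (Nat.card F), c i * x ^ i := by
  classical
  have := Fintype.ofFinite F
  rw [Nat.card_eq_fintype_card]
  have hinj : Set.InjOn (id : F → F) (univ : Finset F) := Function.injective_id.injOn
  set P := Lagrange.interpolate univ (id : F → F) f
  have hdeg : P.natDegree < Fintype.card F :=
    natDegree_lt_of_degree_lt_natCast Fintype.card_pos (Lagrange.degree_interpolate_lt f hinj)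
  refine ⟨P.coeff, fun a ha => coeff_eq_zero_of_natDegree_lt (hdeg.trans_le ha), fun x => ?_⟩
  rw [← eval_eq_sum_range' hdeg]
  exact (Lagrange.eval_interpolate_at_node f hinj (mem_univ x)).symm

open Finset in
theorem sum_mul_add_pow {q : ℕ} {f : ℕ → F} (hf : ∀ a, q ≤ a → f a = 0) (A B : F) :
    ∑ a ∈ range q, f a * (A + B) ^ a =
      ∑ i ∈ range q, ∑ j ∈ range q, f (i + j) * ((i + j).choose i : ℕ) * (A ^ i * B ^ j) := by
  have h1 : ∀ a ∈ range q, f a * (A + B) ^ a = ∑ x ∈ range q ×ˢ range q with x.1 + x.2 = a,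
      f (x.1 + x.2) * ((x.1 + x.2).choose x.1 : ℕ) * (A ^ x.1 * B ^ x.2) := by
    intro a ha
    rw [mem_range] at ha
    have : {x ∈ range q ×ˢ range q | x.1 + x.2 = a} = antidiagonal a := by
      ext ⟨i, j⟩
      simp only [mem_filter, mem_product, mem_range, HasAntidiagonal.mem_antidiagonal]
      omega
    rw [this, (Commute.all A B).add_pow', mul_sum]
    refine sum_congr rfl fun x hx => ?_
    rw [HasAntidiagonal.mem_antidiagonal] at hx
    rw [hx, nsmul_eq_mul, mul_assoc]
  rw [sum_congr rfl h1, sum_fiberwise_eq_sum_filter, sum_filter_of_ne, sum_product]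
  intro x _ hx
  by_contra h
  rw [mem_range, not_lt] at h
  exact hx (by rw [hf _ h, zero_mul, zero_mul])

open Finset in
/-- The value at `(u, v)` of the polynomial with coefficients `c`, of degree less than `q` in each
variable. -/
def evalCoeffs (q : ℕ) (c : ℕ → ℕ → F) (u v : F) : F :=
  ∑ a ∈ range q, ∑ b ∈ range q, c a b * (u ^ a * v ^ b)

open Finset in
theorem eq_zero_of_evalCoeffs_eq_zero [Finite F] {c : ℕ → ℕ → F}
    (h : ∀ u v, evalCoeffs (Nat.card F) c u v = 0) :
    ∀ a < Nat.card F, ∀ b < Nat.card F, c a b = 0 := by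
  intro a ha
  refine eq_zero_of_sum_mul_pow_eq_zero fun v => ?_
  refine eq_zero_of_sum_mul_pow_eq_zero
    (c := fun a => ∑ b ∈ range (Nat.card F), c a b * v ^ b) (fun u => ?_) a ha
  rw [← h u v, evalCoeffs]
  simp_rw [sum_mul]
  exact sum_congr rfl fun _ _ => sum_congr rfl fun _ _ => by ring

theorem exists_eq_evalCoeffs [Finite F] (φ : F → F → F) :
    ∃ c : ℕ → ℕ → F, (∀ a b, Nat.card F ≤ a ∨ Nat.card F ≤ b → c a b = 0) ∧
      ∀ u v, φ u v = evalCoeffs (Nat.card F) c u v := by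
  choose g _ hg using fun u => exists_eq_sum_mul_pow (φ u)
  choose c _ hc using fun b => exists_eq_sum_mul_pow fun u => g u b
  refine ⟨fun a b => if a < Nat.card F ∧ b < Nat.card F then c b a else 0,
    fun a b h => if_neg (by omega), fun u v => ?_⟩
  rw [hg, evalCoeffs, Finset.sum_comm]
  refine Finset.sum_congr rfl fun b hb => ?_
  rw [hc, Finset.sum_mul]
  refine Finset.sum_congr rfl fun a ha => ?_
  rw [if_pos ⟨Finset.mem_range.1 ha, Finset.mem_range.1 hb⟩]
  ring

open Finset in
theorem evalCoeffs_add_left {q : ℕ} {c : ℕ → ℕ → F} (hc : ∀ a b, q ≤ a ∨ q ≤ b → c a b = 0)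
    (A B C : F) : evalCoeffs q c (A + B) C = ∑ i ∈ range q, ∑ j ∈ range q, ∑ k ∈ range q,
      c (i + j) k * ((i + j).choose i : ℕ) * (A ^ i * B ^ j * C ^ k) := by
  have h : evalCoeffs q c (A + B) C = ∑ k ∈ range q,
      (∑ a ∈ range q, c a k * (A + B) ^ a) * C ^ k := by
    rw [evalCoeffs, sum_comm]
    refine sum_congr rfl fun k _ => ?_
    rw [sum_mul]
    exact sum_congr rfl fun a _ => by ring
  rw [h]
  simp_rw [fun k => sum_mul_add_pow (f := fun a => c a k) (fun a h => hc a k (Or.inl h)) A B,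
    sum_mul]
  rw [sum_comm]
  refine sum_congr rfl fun i _ => ?_
  rw [sum_comm]
  exact sum_congr rfl fun j _ => sum_congr rfl fun k _ => by ring

open Finset in
theorem evalCoeffs_add_right {q : ℕ} {c : ℕ → ℕ → F} (hc : ∀ a b, q ≤ a ∨ q ≤ b → c a b = 0)
    (A B C : F) : evalCoeffs q c A (B + C) = ∑ i ∈ range q, ∑ j ∈ range q, ∑ k ∈ range q,
      c i (j + k) * ((j + k).choose j : ℕ) * (A ^ i * B ^ j * C ^ k) := by
  rw [evalCoeffs]
  refine sum_congr rfl fun i _ => ?_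
  calc ∑ b ∈ range q, c i b * (A ^ i * (B + C) ^ b)
      = A ^ i * ∑ b ∈ range q, c i b * (B + C) ^ b := by
        rw [mul_sum]
        exact sum_congr rfl fun b _ => by ring
    _ = _ := by
        rw [sum_mul_add_pow (fun b h => hc i b (Or.inr h)), mul_sum]
        refine sum_congr rfl fun j _ => ?_
        rw [mul_sum]
        exact sum_congr rfl fun k _ => by ring

open Finset in
theorem evalCoeffs_add (q : ℕ) (c c' : ℕ → ℕ → F) (u v : F) :
    evalCoeffs q (fun a b => c a b + c' a b) u v = evalCoeffs q c u v + evalCoeffs q c' u v := by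
  simp only [evalCoeffs, add_mul, sum_add_distrib]

open Finset in
theorem evalCoeffs_coboundary {q : ℕ} {l : ℕ → F} (hl : ∀ a, q ≤ a → l a = 0) (ω s u v : F) :
    evalCoeffs q (fun a b => l (a + b) * (((a + b).choose a : ℕ) * (1 - ω ^ a * s ^ b))) u v =
      ∑ d ∈ range q, l d * (u + v) ^ d - ∑ d ∈ range q, l d * (ω * u + s * v) ^ d := by
  rw [sum_mul_add_pow hl, sum_mul_add_pow hl, evalCoeffs]
  simp only [← sum_sub_distrib]
  exact sum_congr rfl fun a _ => sum_congr rfl fun b _ => by ring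

end PolynomialFunctions

/-! ### Coefficients of `2`-cocycles -/

/-- The cocycle condition on the coefficients of a `2`-cochain `∑ c a b • U₁ ^ a * U₂ ^ b`, where
`s = ω + β`: the coefficient of `A ^ i * B ^ j * C ^ k` after substituting `x₁ = A + B + C`,
`x₂ = B + C`, `x₃ = C`. -/
def IsCocycleCoeffs {F : Type*} [Field F] (ω s : F) (c : ℕ → ℕ → F) : Prop :=
  ∀ i j k, c (i + j) k * ((i + j).choose i : ℕ) * (1 - ω ^ i * s ^ (j + k)) =
    c i (j + k) * ((j + k).choose j : ℕ) * (1 - ω ^ (i + j) * s ^ k)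

section Classification

variable {F : Type*} [Field F]

open Finset in
theorem isCocycleCoeffs_of_forall_evalCoeffs [Finite F] {ω s : F} {c : ℕ → ℕ → F}
    (hc : ∀ a b, Nat.card F ≤ a ∨ Nat.card F ≤ b → c a b = 0)
    (h : ∀ A B C : F, evalCoeffs (Nat.card F) c (A + B) C - evalCoeffs (Nat.card F) c A (B + C) +
      evalCoeffs (Nat.card F) c (ω * A) (ω * B + s * C) -
      evalCoeffs (Nat.card F) c (ω * A + s * B) (s * C) = 0) :
    IsCocycleCoeffs ω s c := by
  set q := Nat.card F
  have key : ∀ i < q, ∀ j < q, ∀ k < q,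
      c (i + j) k * ((i + j).choose i : ℕ) * (1 - ω ^ i * s ^ (j + k)) -
      c i (j + k) * ((j + k).choose j : ℕ) * (1 - ω ^ (i + j) * s ^ k) = 0 := by
    intro i hi
    refine eq_zero_of_evalCoeffs_eq_zero fun B C => ?_
    refine eq_zero_of_sum_mul_pow_eq_zero (c := fun i => evalCoeffs q (fun j k =>
      c (i + j) k * ((i + j).choose i : ℕ) * (1 - ω ^ i * s ^ (j + k)) -
      c i (j + k) * ((j + k).choose j : ℕ) * (1 - ω ^ (i + j) * s ^ k)) B C) (fun A => ?_) i hi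
    rw [← h A B C, evalCoeffs_add_left hc, evalCoeffs_add_left hc, evalCoeffs_add_right hc,
      evalCoeffs_add_right hc]
    simp only [← sum_sub_distrib, ← sum_add_distrib, evalCoeffs, sum_mul]
    refine sum_congr rfl fun i _ => sum_congr rfl fun j _ => sum_congr rfl fun k _ => ?_
    ring
  intro i j k
  by_cases hijk : i < q ∧ j < q ∧ k < q
  · exact sub_eq_zero.1 (key i hijk.1 j hijk.2.1 k hijk.2.2)
  · rw [hc (i + j) k (by omega), hc i (j + k) (by omega)]
    ring

/-- In each total degree `d` a cocycle agrees with a multiple of the coboundary of `x ^ d`, apart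
from the constant term and the coefficients at the exponent pairs of the theorem. In degrees
`d ≥ p ^ m` the multiple is zero, so that only reduced powers `x ^ d` are used. -/
theorem IsCocycleCoeffs.degree_classification {p m : ℕ} [CharP F p] (hp : p.Prime) {ω s : F}
    {c : ℕ → ℕ → F} (hωs : ω ≠ s)
    (hc : ∀ a b, p ^ m ≤ a ∨ p ^ m ≤ b → c a b = 0) (hE : IsCocycleCoeffs ω s c) (d : ℕ) :
    ∃ l : F, (p ^ m ≤ d → l = 0) ∧ ∀ a b, a + b = d →
      c a b = l * ((d.choose a : ℕ) * (1 - ω ^ a * s ^ b)) ∨ (a = 0 ∧ b = 0) ∨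
      ∃ v u, v < u ∧ u < m ∧ ω ^ (p ^ v + p ^ u) = 1 ∧ s ^ (p ^ v + p ^ u) = 1 ∧
        a = p ^ v ∧ b = p ^ u := by
  rcases eq_or_ne d 0 with rfl | hd0
  · exact ⟨0, fun _ => rfl, fun a b h => Or.inr (Or.inl (by omega))⟩
  by_cases hs : s ^ d = 1
  swap
  · have hs' : 1 - s ^ d ≠ 0 := sub_ne_zero.2 (Ne.symm hs)
    refine ⟨c 0 d / (1 - s ^ d), fun h => by rw [hc 0 d (Or.inr h), zero_div],
      fun a b hab => Or.inl ?_⟩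
    subst hab
    have h := hE 0 a b
    simp only [zero_add, Nat.choose_zero_right, pow_zero, Nat.cast_one, one_mul, mul_one] at h
    field_simp
    linear_combination h
  by_cases hωd : ω ^ d = 1
  swap
  · have hω' : 1 - ω ^ d ≠ 0 := sub_ne_zero.2 (Ne.symm hωd)
    refine ⟨c d 0 / (1 - ω ^ d), fun h => by rw [hc d 0 (Or.inl h), zero_div],
      fun a b hab => Or.inl ?_⟩
    subst hab
    have h := hE a b 0
    simp only [add_zero, Nat.choose_self, pow_zero, Nat.cast_one, mul_one] at h
    field_simp
    linear_combination -h
  have hs0 : s ≠ 0 := by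
    rintro rfl
    rw [zero_pow hd0] at hs
    exact zero_ne_one hs
  have hτ : ω / s ≠ 1 := fun h => hωs ((div_eq_one_iff_eq hs0).1 h)
  -- with `s ^ d = 1` the factors `1 - ω ^ a * s ^ b` depend only on `ω / s`
  have hpow : ∀ a b, a + b = d → ω ^ a * s ^ b = (ω / s) ^ a := by
    intro a b hab
    rw [div_pow, eq_div_iff (pow_ne_zero _ hs0), mul_assoc, ← pow_add, add_comm b, hab, hs, mul_one]
  obtain ⟨l, hl⟩ := slice_classification (p := p) (c := fun a => c a (d - a)) hp hd0 hτ
    (by rw [div_pow, hωd, hs, div_one]) (by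
      intro i j k hijk
      have h := hE i j k
      rw [hpow i (j + k) (by omega), hpow (i + j) k (by omega)] at h
      simpa only [show d - (i + j) = k by omega, show d - i = j + k by omega] using h)
  have hl' : ∀ a b, a + b = d → c a b = l * ((d.choose a : ℕ) * (1 - ω ^ a * s ^ b)) ∨
      ∃ v u, v < u ∧ a = p ^ v ∧ b = p ^ u := by
    intro a b hab
    rcases hl a (by omega) with h | ⟨v, u, hvu, rfl, h⟩
    · left
      rw [hpow a b hab, ← h, ← hab, Nat.add_sub_cancel_left]
    · exact Or.inr ⟨v, u, hvu, rfl, by omega⟩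
  have hsmall : ∀ v u, v < u → u < m → p ^ v + p ^ u < p ^ m := by
    intro v u hvu hum
    have h1 : p ^ v < p ^ u := Nat.pow_lt_pow_right hp.one_lt hvu
    have h2 : p ^ u * 2 ≤ p ^ u * p := Nat.mul_le_mul_left _ hp.two_le
    have h3 : p ^ (u + 1) ≤ p ^ m := Nat.pow_le_pow_right hp.pos hum
    rw [pow_succ] at h3
    omega
  by_cases hdm : p ^ m ≤ d
  swap
  · refine ⟨l, fun h => absurd h hdm, fun a b hab => (hl' a b hab).imp_right fun h => Or.inr ?_⟩
    obtain ⟨v, u, hvu, rfl, rfl⟩ := h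
    exact ⟨v, u, hvu, (Nat.pow_lt_pow_iff_right hp.one_lt).1 (by omega), hab ▸ hωd, hab ▸ hs,
      rfl, rfl⟩
  -- in degrees at least `p ^ m` no coefficient survives
  refine ⟨0, fun _ => rfl, fun a b hab => Or.inl ?_⟩
  rw [zero_mul]
  by_cases hab' : p ^ m ≤ a ∨ p ^ m ≤ b
  · exact hc a b hab'
  rcases hl' a b hab with h | ⟨v, u, hvu, rfl, rfl⟩
  swap
  · have := hsmall v u hvu ((Nat.pow_lt_pow_iff_right hp.one_lt).1 (by omega))
    omega
  suffices hl0 : l = 0 by rw [h, hl0, zero_mul]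
  -- the coefficient at `p ^ m` is out of range, but that of the coboundary is not zero there
  obtain ⟨r, rfl⟩ := Nat.exists_eq_add_of_le hdm
  rcases hl' (p ^ m) r rfl with h' | ⟨v, u, hvu, hv, hu⟩
  swap
  · have : p ^ v < p ^ u := Nat.pow_lt_pow_right hp.one_lt hvu
    omega
  rw [hc _ _ (Or.inl le_rfl), hpow _ r rfl] at h'
  have hC : ((p ^ m + r).choose (p ^ m) : F) = 1 := by
    have := Fact.mk hp
    have h := (CharP.intCast_eq_intCast F p).2
      (Choose.choose_modEq_choose_mul_prod_range_choose (n := p ^ m + r) (k := p ^ m) (p := p) m)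
    have hr : (p ^ m + r) / p ^ m = 1 := by
      rw [Nat.add_div_left _ (pow_pos hp.pos m), Nat.div_eq_of_lt (by omega)]
    have hprod : ∀ i ∈ Finset.range m,
        ((p ^ m + r) / p ^ i % p).choose (p ^ m / p ^ i % p) = 1 := by
      intro i hi
      rw [Nat.pow_div (Finset.mem_range.1 hi).le hp.pos, Nat.mod_eq_zero_of_dvd
        (dvd_pow_self p (Nat.sub_ne_zero_of_lt (Finset.mem_range.1 hi))), Nat.choose_zero_right]
    rw [hr, Nat.div_self (pow_pos hp.pos m), Finset.prod_congr rfl hprod] at h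
    simpa using h
  rw [hC, one_mul] at h'
  exact (mul_eq_zero.1 h'.symm).resolve_right (one_sub_pow_prime_pow_ne_zero hp hτ m)

end Classification

/-! ### Low-degree cochains and bases of cohomology -/

namespace FQuandle

variable {X : Type*} (Q : FQuandle X) {F : Type*} [Field F]

theorem delta_one_apply (ψ : (Fin 1 → X) → F) (x : Fin 2 → X) :
    Q.delta F 1 ψ x = ψ (fun _ => x 0) - ψ (fun _ => Q.op (x 0) (x 1)) := by
  have h1 : (Fin.removeNth 1 x : Fin 1 → X) = fun _ => x 0 := by
    funext j
    fin_cases j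
    rfl
  have h2 : Q.act 0 x = fun _ => Q.op (x 0) (x 1) := by
    funext j
    fin_cases j
    rfl
  simp [delta, h1, h2]

theorem delta_two_apply (φ : (Fin 2 → X) → F) (x : Fin 3 → X) :
    Q.delta F 2 φ x = φ ![x 0, x 1] - φ ![x 0, x 2] + φ ![Q.op (x 0) (x 1), Q.f (x 2)] -
      φ ![Q.op (x 0) (x 2), Q.op (x 1) (x 2)] := by
  have h1 : (Fin.removeNth 1 x : Fin 2 → X) = ![x 0, x 2] := by
    funext j
    fin_cases j <;> rfl
  have h2 : (Fin.removeNth 2 x : Fin 2 → X) = ![x 0, x 1] := by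
    funext j
    fin_cases j <;> rfl
  have h3 : Q.act 0 x = ![Q.op (x 0) (x 1), Q.f (x 2)] := by
    funext j
    fin_cases j <;> rfl
  have h4 : Q.act 1 x = ![Q.op (x 0) (x 2), Q.op (x 1) (x 2)] := by
    funext j
    fin_cases j <;> rfl
  have e2 : (Fin.succ 1 : Fin 3) = 2 := rfl
  simp [delta, Fin.sum_univ_two, h1, h2, h3, h4, e2, pow_succ]
  ring

theorem delta_one_mem_coboundaries {s : ℕ} (ψ : (Fin 1 → X) → F) :
    Q.delta F 1 ψ ∈ Q.coboundaries F s 2 :=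
  -- in degree `1` the normalization is vacuous
  Submodule.mem_map_of_mem fun _ j hj =>
    absurd (Nat.lt_of_succ_lt_succ hj) (Nat.not_lt_zero j)

/-- Cocycles whose classes are independent and spanning give a basis of the cohomology. -/
theorem exists_basis_cohomology {ι : Type*} {s n : ℕ} (f : ι → (Fin n → X) → F)
    (hf : ∀ i, f i ∈ Q.cocycles F s n)
    (hind : ∀ g : ι →₀ F, Finsupp.linearCombination F f g ∈ Q.coboundaries F s n → g = 0)
    (hspan : ∀ φ ∈ Q.cocycles F s n, ∃ g : ι →₀ F,
      φ - Finsupp.linearCombination F f g ∈ Q.coboundaries F s n) :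
    ∃ b : Module.Basis ι F (Q.Cohomology F s n), ∀ i, ∃ z : Q.cocycles F s n,
      (z : (Fin n → X) → F) = f i ∧ b i = Q.cohomologyClass F s n z := by
  set z : ι → Q.cocycles F s n := fun i => ⟨f i, hf i⟩
  have hzf : ∀ g : ι →₀ F, ((Finsupp.linearCombination F z g : Q.cocycles F s n) :
      (Fin n → X) → F) = Finsupp.linearCombination F f g := by
    intro g
    rw [← Submodule.coe_subtype, Finsupp.apply_linearCombination]
    rfl
  set π := ((Q.coboundaries F s n).comap (Q.cocycles F s n).subtype).mkQ with hπ
  have hcl : ∀ g : ι →₀ F, Finsupp.linearCombination F (fun i => Q.cohomologyClass F s n (z i)) g =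
      π (Finsupp.linearCombination F z g) := by
    intro g
    rw [Finsupp.apply_linearCombination]
    rfl
  refine ⟨Module.Basis.mk (v := fun i => Q.cohomologyClass F s n (z i)) ?_ ?_,
    fun i => ⟨z i, rfl, Module.Basis.mk_apply _ _ i⟩⟩
  · rw [linearIndependent_iff]
    intro g hg
    rw [hcl, hπ, Submodule.mkQ_apply, Submodule.Quotient.mk_eq_zero, Submodule.mem_comap,
      Submodule.coe_subtype, hzf] at hg
    exact hind g hg
  · rintro y -
    obtain ⟨φ, rfl⟩ := Submodule.Quotient.mk_surjective _ y
    obtain ⟨g, hg⟩ := hspan φ φ.2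
    rw [Finsupp.mem_span_range_iff_exists_finsupp]
    refine ⟨g, ?_⟩
    rw [← Finsupp.linearCombination_apply, hcl, hπ, Submodule.mkQ_apply, eq_comm,
      Submodule.Quotient.eq, Submodule.mem_comap, Submodule.coe_subtype, Submodule.coe_sub, hzf]
    exact hg

end FQuandle

/-! ### Combinations of the distinguished monomials -/

section Monomials

variable {F : Type*} [Field F] {p m : ℕ} {ω β : F}

theorem finite_exponentPairs (p m : ℕ) (ω β : F) : (exponentPairs p m ω β).Finite :=
  ((Set.finite_Iio m).prod (Set.finite_Iio m)).subset fun _ he =>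
    ⟨he.1.trans he.2.1, he.2.1⟩

open Finset in
/-- The coefficient of `U₁ ^ a * U₂ ^ b` in a combination of the monomials indexed by
`exponentPairs`. -/
def combinationCoeffs (g : exponentPairs p m ω β →₀ F) (a b : ℕ) : F :=
  ∑ e ∈ g.support, if p ^ e.1.1 = a ∧ p ^ e.1.2 = b then g e else 0

theorem combinationCoeffs_self (hp : p.Prime) (g : exponentPairs p m ω β →₀ F)
    (e : exponentPairs p m ω β) : combinationCoeffs g (p ^ e.1.1) (p ^ e.1.2) = g e := by
  rw [combinationCoeffs, Finset.sum_eq_single e]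
  · exact if_pos ⟨rfl, rfl⟩
  · intro e' _ hne
    refine if_neg fun h => hne (Subtype.ext (Prod.ext ?_ ?_))
    · exact Nat.pow_right_injective hp.two_le h.1
    · exact Nat.pow_right_injective hp.two_le h.2
  · intro h
    rw [Finsupp.notMem_support_iff.1 h, ite_self]

theorem combinationCoeffs_eq_zero (g : exponentPairs p m ω β →₀ F) {a b : ℕ}
    (h : ∀ e ∈ exponentPairs p m ω β, ¬ (p ^ e.1 = a ∧ p ^ e.2 = b)) :
    combinationCoeffs g a b = 0 :=
  Finset.sum_eq_zero fun e _ => if_neg (h e.1 e.2)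

open Finset in
theorem linearCombination_monomialCochain (hp : p.Prime) (g : exponentPairs p m ω β →₀ F)
    (x : Fin 2 → F) :
    Finsupp.linearCombination F
      (fun e : exponentPairs p m ω β => monomialCochain (F := F) (p ^ e.1.1) (p ^ e.1.2)) g x =
      evalCoeffs (p ^ m) (combinationCoeffs g) (x 0 - x 1) (x 1) := by
  have h1 : ∀ a b, combinationCoeffs g a b * ((x 0 - x 1) ^ a * x 1 ^ b) = ∑ e ∈ g.support,
      if p ^ e.1.1 = a then (if p ^ e.1.2 = b then g e * ((x 0 - x 1) ^ a * x 1 ^ b) else 0)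
        else 0 := by
    intro a b
    rw [combinationCoeffs, sum_mul]
    exact sum_congr rfl fun e _ => by rw [ite_and, ite_mul, ite_mul, zero_mul]
  have h2 : ∀ u < m, p ^ u < p ^ m := fun u hu => Nat.pow_lt_pow_right hp.one_lt hu
  rw [Finsupp.linearCombination_apply, Finsupp.sum, Finset.sum_apply, evalCoeffs]
  simp_rw [h1]
  rw [sum_congr rfl fun _ _ => sum_comm, sum_comm]
  refine sum_congr rfl fun e _ => ?_
  rw [sum_eq_single_of_mem (p ^ e.1.1) (mem_range.2 (h2 _ (e.2.1.trans e.2.2.1)))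
      fun a _ ha => sum_eq_zero fun b _ => if_neg ha.symm,
    sum_eq_single_of_mem (p ^ e.1.2) (mem_range.2 (h2 _ e.2.2.1))
      fun b _ hb => by rw [if_pos rfl, if_neg hb.symm],
    if_pos rfl, if_pos rfl]
  rfl

end Monomials

/-! ### Cocycles of the Alexander `f`-quandle -/

section AlexanderFQuandle

variable {F : Type*} [Field F] {p m : ℕ} {ω β : F}

/-- The coboundary of a `1`-cochain in the coordinates `U₁ = x₁ - x₂`, `U₂ = x₂`. -/
theorem alexander_delta_one_apply (hω0 : ω ≠ 0) (ψ : (Fin 1 → F) → F) (x : Fin 2 → F) :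
    (alexanderFQuandle ω β hω0).delta F 1 ψ x =
      ψ (fun _ => (x 0 - x 1) + x 1) -
        ψ (fun _ => ω * (x 0 - x 1) + (ω + β) * x 1) := by
  rw [FQuandle.delta_one_apply, sub_add_cancel,
    show ω * (x 0 - x 1) + (ω + β) * x 1 = ω * x 0 + β * x 1 by ring]
  rfl

theorem monomialCochain_mem_cocycles [CharP F p] (hp : p.Prime) (hω0 : ω ≠ 0) (s : ℕ) {v u : ℕ}
    (hω : ω ^ (p ^ v + p ^ u) = 1) (hs : (ω + β) ^ (p ^ v + p ^ u) = 1) :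
    monomialCochain (p ^ v) (p ^ u) ∈ (alexanderFQuandle ω β hω0).cocycles F s 2 := by
  have := Fact.mk hp
  refine ⟨LinearMap.mem_ker.2 (funext fun x => ?_), fun x j hj _ hx => ?_⟩
  · rw [FQuandle.delta_two_apply]
    obtain ⟨A, hA⟩ : ∃ A, A = x 0 - x 1 := ⟨_, rfl⟩
    obtain ⟨B, hB⟩ : ∃ B, B = x 1 - x 2 := ⟨_, rfl⟩
    have e0 : x 0 = A + B + x 2 := by rw [hA, hB]; ring
    have e1 : x 1 = B + x 2 := by rw [hB]; ring
    simp only [monomialCochain, alexanderFQuandle, Matrix.cons_val_zero, Matrix.cons_val_one,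
      e0, e1, Pi.zero_apply]
    generalize x 2 = C
    rw [show A + B + C - (B + C) = A by ring, show A + B + C - C = A + B by ring,
      show ω * (A + B + C) + β * (B + C) - (ω + β) * C = ω * A + (ω + β) * B by ring,
      show ω * (A + B + C) + β * C - (ω * (B + C) + β * C) = ω * A by ring,
      show ω * (B + C) + β * C = ω * B + (ω + β) * C by ring]
    simp only [add_pow_char_pow (p := p), mul_pow] at *
    simp only [pow_add] at hω hs
    rw [add_pow_char_pow, add_pow_char_pow] at hs
    linear_combination (-A ^ p ^ v * B ^ p ^ u) * hω + (B ^ p ^ v * C ^ p ^ u) * hs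
  · obtain rfl : j = 0 := by omega
    change x 0 = x 1 at hx
    rw [monomialCochain, hx, sub_self, zero_pow (pow_ne_zero _ hp.ne_zero), zero_mul]

theorem one_mem_cocycles (hω0 : ω ≠ 0) :
    (fun _ => 1) ∈ (alexanderFQuandle ω β hω0).cocycles F 2 2 := by
  refine ⟨LinearMap.mem_ker.2 (funext fun x => ?_), fun x j hj hs _ => by omega⟩
  rw [FQuandle.delta_two_apply, Pi.zero_apply]
  ring

/-- No nonzero combination of the distinguished monomials is a coboundary: in a coboundary the
coefficients at `(p ^ v, p ^ u)` and `(p ^ u, p ^ v)` vanish together. -/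
theorem eq_zero_of_linearCombination_eq_delta [Finite F] (hp : p.Prime)
    (hF : Nat.card F = p ^ m) [CharP F p] (hω0 : ω ≠ 0) (hβ : β ≠ 0)
    (g : exponentPairs p m ω β →₀ F) (ψ : (Fin 1 → F) → F)
    (h : Finsupp.linearCombination F
      (fun e : exponentPairs p m ω β => monomialCochain (F := F) (p ^ e.1.1) (p ^ e.1.2)) g =
      (alexanderFQuandle ω β hω0).delta F 1 ψ) : g = 0 := by
  obtain ⟨l, hl, hψ⟩ := exists_eq_sum_mul_pow fun x => ψ fun _ => x
  have hzero : ∀ u v, evalCoeffs (Nat.card F) (fun a b => -combinationCoeffs g a b +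
      l (a + b) * (((a + b).choose a : ℕ) * (1 - ω ^ a * (ω + β) ^ b))) u v = 0 := by
    intro u v
    have hx := congrFun h ![u + v, v]
    rw [linearCombination_monomialCochain hp, alexander_delta_one_apply, hψ, hψ,
      ← evalCoeffs_coboundary hl, ← hF] at hx
    simp only [Matrix.cons_val_zero, Matrix.cons_val_one, add_sub_cancel_right] at hx
    rw [evalCoeffs_add, ← hx]
    simp [evalCoeffs]
  have hcoef := eq_zero_of_evalCoeffs_eq_zero hzero
  rw [hF] at hcoef
  ext e
  obtain ⟨⟨v, u⟩, he⟩ := e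
  obtain ⟨hvu, hum, hω, hs⟩ := id he
  simp only at hvu hum hω hs
  have hpu : p ^ u < p ^ m := Nat.pow_lt_pow_right hp.one_lt hum
  have hpv : p ^ v < p ^ m := Nat.pow_lt_pow_right hp.one_lt (hvu.trans hum)
  have h1 := hcoef _ hpv _ hpu
  have h2 := hcoef _ hpu _ hpv
  rw [combinationCoeffs_self hp g ⟨(v, u), he⟩] at h1
  rw [combinationCoeffs_eq_zero, neg_zero, zero_add, add_comm (p ^ u)] at h2
  swap
  · rintro ⟨v', u'⟩ he' ⟨h3, h4⟩
    have h3 := Nat.pow_right_injective hp.two_le h3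
    have h4 := Nat.pow_right_injective hp.two_le h4
    have := he'.1
    simp only at this h3 h4
    omega
  -- the coboundary of `x ^ (p ^ v + p ^ u)` has a nonzero coefficient at `(p ^ u, p ^ v)`
  have hC : ((p ^ v + p ^ u).choose (p ^ u) : F) ≠ 0 := by
    obtain ⟨k, rfl⟩ := Nat.exists_eq_add_of_lt hvu
    have hsum : p ^ v + p ^ (v + k + 1) = p ^ v * (1 + p * p ^ k) := by ring
    have hmul : p ^ (v + k + 1) = p ^ v * (p * p ^ k) := by ring
    have := Fact.mk hp
    rw [hsum, hmul, (CharP.natCast_eq_natCast F p).2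
      Choose.choose_pow_mul_pow_mul_modEq_choose_nat]
    have h := cast_choose_add_mul (F := F) hp hp.one_lt hp.pos (p ^ k) (p ^ k)
    rw [zero_add] at h
    rw [h]
    simp
  have hs0 : ω + β ≠ 0 := by
    intro h0
    rw [h0, zero_pow (by have := pow_pos hp.pos v; omega)] at hs
    exact zero_ne_one hs
  have hfac : 1 - ω ^ p ^ u * (ω + β) ^ p ^ v ≠ 0 := by
    have hτ : ω / (ω + β) ≠ 1 := by
      rw [Ne, div_eq_one_iff_eq hs0]
      intro h'
      exact hβ (by linear_combination -h')
    have := one_sub_pow_prime_pow_ne_zero hp hτ u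
    rw [div_pow] at this
    convert this using 2
    rw [eq_div_iff (pow_ne_zero _ hs0), mul_assoc, ← pow_add, hs, mul_one]
  have hl0 : l (p ^ v + p ^ u) = 0 :=
    (mul_eq_zero.1 h2).resolve_right (mul_ne_zero hC hfac)
  rw [hl0, zero_mul, add_zero, neg_eq_zero] at h1
  exact h1

/-- Every `2`-cocycle is a constant plus a combination of the distinguished monomials plus a
coboundary. -/
theorem exists_eq_const_add_linearCombination_add_delta [Finite F] (hp : p.Prime)
    (hF : Nat.card F = p ^ m) [CharP F p] (hω0 : ω ≠ 0) (hβ : β ≠ 0) {φ : (Fin 2 → F) → F}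
    (hφ : φ ∈ LinearMap.ker ((alexanderFQuandle ω β hω0).delta F 2)) :
    ∃ (k : F) (g : exponentPairs p m ω β →₀ F) (ψ : (Fin 1 → F) → F),
      φ = k • (fun _ => 1) + Finsupp.linearCombination F (fun e : exponentPairs p m ω β =>
        monomialCochain (F := F) (p ^ e.1.1) (p ^ e.1.2)) g +
        (alexanderFQuandle ω β hω0).delta F 1 ψ := by
  obtain ⟨c, hc, hφc⟩ := exists_eq_evalCoeffs fun u v => φ ![u + v, v]
  have hφc' : ∀ x y, φ ![x, y] = evalCoeffs (Nat.card F) c (x - y) y := fun x y => by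
    rw [← hφc, sub_add_cancel]
  have hE : IsCocycleCoeffs ω (ω + β) c := by
    refine isCocycleCoeffs_of_forall_evalCoeffs hc fun A B C => ?_
    have h := congrFun (LinearMap.mem_ker.1 hφ) ![A + B + C, B + C, C]
    rw [FQuandle.delta_two_apply] at h
    simp only [alexanderFQuandle, Matrix.cons_val_zero, Matrix.cons_val_one, Matrix.cons_val,
      hφc', Pi.zero_apply] at h
    rw [show A + B + C - (B + C) = A by ring, show A + B + C - C = A + B by ring,
      show ω * (A + B + C) + β * (B + C) - (ω + β) * C = ω * A + (ω + β) * B by ring,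
      show ω * (A + B + C) + β * C - (ω * (B + C) + β * C) = ω * A by ring,
      show ω * (B + C) + β * C = ω * B + (ω + β) * C by ring] at h
    linear_combination -h
  rw [hF] at hc
  choose l hl hcl using hE.degree_classification hp (fun h => hβ (by linear_combination -h)) hc
  -- `r` collects the coefficients not accounted for by the coboundary
  obtain ⟨r, hr⟩ : ∃ r : ℕ → ℕ → F, ∀ a b, r a b =
      c a b - l (a + b) * (((a + b).choose a : ℕ) * (1 - ω ^ a * (ω + β) ^ b)) :=
    ⟨_, fun _ _ => rfl⟩
  have := (finite_exponentPairs p m ω β).to_subtype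
  obtain ⟨g, hg⟩ : ∃ g : exponentPairs p m ω β →₀ F, ∀ e, g e = r (p ^ e.1.1) (p ^ e.1.2) :=
    ⟨Finsupp.equivFunOnFinite.symm fun e => r (p ^ e.1.1) (p ^ e.1.2), fun _ => rfl⟩
  have hcoef : c = fun a b => ((if a = 0 ∧ b = 0 then r 0 0 else 0) + combinationCoeffs g a b) +
      l (a + b) * (((a + b).choose a : ℕ) * (1 - ω ^ a * (ω + β) ^ b)) := by
    funext a b
    rw [← sub_eq_iff_eq_add, ← hr]
    by_cases h : ∃ e ∈ exponentPairs p m ω β, p ^ e.1 = a ∧ p ^ e.2 = b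
    · obtain ⟨e, he, rfl, rfl⟩ := h
      rw [if_neg fun h => pow_ne_zero _ hp.ne_zero h.1, zero_add,
        combinationCoeffs_self hp g ⟨e, he⟩, hg]
    · rw [combinationCoeffs_eq_zero g fun e he h' => h ⟨e, he, h'⟩, add_zero]
      rcases hcl (a + b) a b rfl with h' | ⟨rfl, rfl⟩ | ⟨v, u, hvu, hum, hω, hs, rfl, rfl⟩
      · have hr0 : r a b = 0 := by rw [hr, h', sub_self]
        rw [hr0]
        split_ifs with h0
        · rw [← hr0, h0.1, h0.2]
        · rfl
      · rw [if_pos ⟨rfl, rfl⟩]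
      · exact absurd ⟨(v, u), ⟨hvu, hum, hω, hs⟩, rfl, rfl⟩ h
  have hconst : ∀ u v, evalCoeffs (p ^ m)
      (fun a b => if a = 0 ∧ b = 0 then r 0 0 else 0) u v = r 0 0 := by
    intro u v
    have h0 : 0 ∈ Finset.range (p ^ m) := Finset.mem_range.2 (pow_pos hp.pos m)
    rw [evalCoeffs, Finset.sum_eq_single_of_mem 0 h0, Finset.sum_eq_single_of_mem 0 h0]
    · simp
    · intro b _ hb
      simp [hb]
    · intro a _ ha
      simp [ha]
  refine ⟨r 0 0, g, fun y => ∑ d ∈ Finset.range (p ^ m), l d * y 0 ^ d, funext fun x => ?_⟩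
  have hx : x = ![x 0, x 1] := by
    funext j
    fin_cases j <;> rfl
  simp only [Pi.add_apply, Pi.smul_apply, smul_eq_mul, mul_one]
  rw [linearCombination_monomialCochain hp, alexander_delta_one_apply,
    ← evalCoeffs_coboundary hl, ← hconst (x 0 - x 1) (x 1), ← evalCoeffs_add, ← evalCoeffs_add,
    ← hcoef, ← hF, ← hφc', ← hx]

theorem delta_one_apply_zero (hω0 : ω ≠ 0) (ψ : (Fin 1 → F) → F) :
    (alexanderFQuandle ω β hω0).delta F 1 ψ 0 = 0 := by
  rw [alexander_delta_one_apply]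
  simp

theorem linearCombination_monomialCochain_zero (hp : p.Prime) (g : exponentPairs p m ω β →₀ F) :
    Finsupp.linearCombination F (fun e : exponentPairs p m ω β =>
      monomialCochain (F := F) (p ^ e.1.1) (p ^ e.1.2)) g 0 = 0 := by
  rw [Finsupp.linearCombination_apply, Finsupp.sum, Finset.sum_apply]
  refine Finset.sum_eq_zero fun e _ => ?_
  simp [monomialCochain, hp.ne_zero]

end AlexanderFQuandle

theorem theorem3p2 {F : Type*} [Field F] [Finite F] (p m : ℕ) (hp : p.Prime)
    (hF : Nat.card F = p ^ m) (ω β : F) (hω0 : ω ≠ 0) (hω1 : ω ≠ 1) (hβ : β ≠ 0) :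
    (∃ b : Module.Basis (exponentPairs p m ω β) F ((alexanderFQuandle ω β hω0).HQ F 2),
      ∀ e : exponentPairs p m ω β, ∃ z : (alexanderFQuandle ω β hω0).cocycles F 1 2,
        (z : (Fin 2 → F) → F) = monomialCochain (p ^ e.1.1) (p ^ e.1.2) ∧
        b e = (alexanderFQuandle ω β hω0).cohomologyClass F 1 2 z) ∧
    (∃ b : Module.Basis (Option (exponentPairs p m ω β)) F
        ((alexanderFQuandle ω β hω0).HLate F 2),
      (∃ z : (alexanderFQuandle ω β hω0).cocycles F 2 2,
        (z : (Fin 2 → F) → F) = (fun _ => 1) ∧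
        b none = (alexanderFQuandle ω β hω0).cohomologyClass F 2 2 z) ∧
      ∀ e : exponentPairs p m ω β, ∃ z : (alexanderFQuandle ω β hω0).cocycles F 2 2,
        (z : (Fin 2 → F) → F) = monomialCochain (p ^ e.1.1) (p ^ e.1.2) ∧
        b (some e) = (alexanderFQuandle ω β hω0).cohomologyClass F 2 2 z) := by
  have := Fact.mk hp
  have : CharP F p := by
    have := Fintype.ofFinite F
    exact charP_of_card_eq_prime_pow (f := m) (by rw [← Nat.card_eq_fintype_card, hF])
  set Q := alexanderFQuandle ω β hω0
  set M : exponentPairs p m ω β → (Fin 2 → F) → F :=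
    fun e => monomialCochain (p ^ e.1.1) (p ^ e.1.2)
  have hM : ∀ s e, M e ∈ Q.cocycles F s 2 := fun s e =>
    monomialCochain_mem_cocycles hp hω0 s e.2.2.2.1 e.2.2.2.2
  refine ⟨Q.exists_basis_cohomology M (hM 1) ?_ ?_, ?_⟩
  · rintro g ⟨ψ, -, hψ⟩
    exact eq_zero_of_linearCombination_eq_delta hp hF hω0 hβ g ψ hψ.symm
  · rintro φ ⟨hφ, hφ0⟩
    obtain ⟨k, g, ψ, rfl⟩ :=
      exists_eq_const_add_linearCombination_add_delta hp hF hω0 hβ hφ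
    -- the constant is the value at `(0, 0)`, a degenerate pair
    have hk : k = 0 := by
      have h := hφ0 0 0 (by omega) (by omega) rfl
      simpa only [Pi.add_apply, Pi.smul_apply, smul_eq_mul, mul_one, delta_one_apply_zero,
        linearCombination_monomialCochain_zero hp, add_zero] using h
    refine ⟨g, ?_⟩
    rw [hk, zero_smul, zero_add, add_sub_cancel_left]
    exact Q.delta_one_mem_coboundaries ψ
  · set N : Option (exponentPairs p m ω β) → (Fin 2 → F) → F := fun o => o.elim (fun _ => 1) M
    have hN : ∀ o, N o ∈ Q.cocycles F 2 2 := by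
      rintro (_ | e)
      · exact one_mem_cocycles hω0
      · exact hM 2 e
    have hcomb : ∀ g, Finsupp.linearCombination F N g =
        g none • (fun _ => 1) + Finsupp.linearCombination F M g.some := fun g =>
      Finsupp.linearCombination_option F N g
    have hind : ∀ g, Finsupp.linearCombination F N g ∈ Q.coboundaries F 2 2 → g = 0 := by
      rintro g ⟨ψ, -, hψ⟩
      rw [hcomb] at hψ
      have h0 : g none = 0 := by
        have h := congrFun hψ 0
        rw [delta_one_apply_zero] at h
        simpa only [Pi.add_apply, Pi.smul_apply, smul_eq_mul, mul_one,
          linearCombination_monomialCochain_zero hp, add_zero, M] using h.symm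
      rw [h0, zero_smul, zero_add] at hψ
      have h1 := eq_zero_of_linearCombination_eq_delta hp hF hω0 hβ g.some ψ hψ.symm
      ext (_ | e)
      · exact h0
      · exact DFunLike.congr_fun h1 e
    have hspan : ∀ φ ∈ Q.cocycles F 2 2, ∃ g,
        φ - Finsupp.linearCombination F N g ∈ Q.coboundaries F 2 2 := by
      rintro φ ⟨hφ, -⟩
      obtain ⟨k, g, ψ, rfl⟩ :=
        exists_eq_const_add_linearCombination_add_delta hp hF hω0 hβ hφ
      refine ⟨g.optionElim k, ?_⟩
      rw [hcomb, Finsupp.optionElim_apply_none, Finsupp.some_optionElim, add_sub_cancel_left]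
      exact Q.delta_one_mem_coboundaries ψ
    obtain ⟨b, hb⟩ := Q.exists_basis_cohomology N hN hind hspan
    exact ⟨b, hb none, fun e => hb (some e)⟩
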